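/- Fix a canonical one-parameter exponential family: a measure $\rho$ on $\mathbb R$, an interval $\Theta\subseteq\mathbb R$ and a function $b$ such that for every $\theta\in\Theta$ the density $\frac{d\nu_\theta}{d\rho}(x)=\exp(\theta x-b(\theta))$ defines a probability distribution $\nu_\theta$ with finite mean. A model $\nu=\{G,(\nu_u)_{u\in V}\}$ with vertex set $V=\{1,\dots,K\}$ consists of a matrix $G\in[0,1]^{K\times K}$ and of members $\nu_u=\nu_{\theta_u}$, $\theta_u\in\Theta$, of the family, with means $\mu_u$. It is observable if for every $u$ there is $v$ with $G_{v,u}>0$; when the maximiser of $u\mapsto\mu_u$ is unique it is denoted $a^\star=a^\star(\nu)$. In round $t=1,2,\dots$ a learner chooses $V_t\in V$ and observes only $Z_t=(Z_{t,u})_{u\in V}$ with $Z_{t,u}=Y_{t,(V_t,u)}R_{t,u}$, where the variables $Y_{t,(v,u)}\sim\mathrm{Ber}(G_{v,u})$ and $R_{t,u}\sim\nu_u$ are all independent (uninformed setting: neither $G$ nor the activated edges are revealed). With $\mathcal F_t=\sigma(V_1,Z_1,\dots,V_t,Z_t)$, an algorithm, which does not depend on the model, consists of an $\mathcal F_{t-1}$-measurable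 choice $V_t$ for each $t$, a stopping time $\tau$ of $(\mathcal F_t)_t$ with values in $\{0,1,2,\dots\}\cup\{\infty\}$, and an $\mathcal F_\tau$-measurable recommendation $\hat a_\tau\in V$. It is $\delta$-PC if $\mathbb P_\nu(\tau<\infty,\ \hat a_\tau\neq a^\star(\nu))<\delta$ for every observable model $\nu$ of the family with $K$ vertices and a unique best vertex. **Theorem.** Let $0<\delta\le 1/2$. For every $\delta$-PC algorithm and every observable model $\nu$ with a unique best vertex $a^\star$ whose reward distributions $\nu_u$ are continuous (have no atoms), $$\mathbb E_\nu[\tau]\ \ge\ T^\star(\nu)\,\mathrm{kl}(\delta,1-\delta),\qquad \mathrm{kl}(x,y)=x\ln\tfrac xy+(1-x)\ln\tfrac{1-x}{1-y},$$ where, with $\Delta(V)$ the probability simplex over $V$ and $m=G^\top\omega$, that is $m_u=\sum_{v\in V}\omega_vG_{v,u}$, $$(T^\star(\nu))^{-1}=\sup_{\omega\in\Delta(V)}\ \min_{u\ne a^\star}\ (m_u+m_{a^\star})\,I_{\frac{m_{a^\star}}{m_u+m_{a^\star}}}(\nu_{a^\star},\nu_u)$$ (a term with $m_u+m_{a^\star}=0$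 is $0$, and a minimum over the empty set is $+\infty$). Here, for $\alpha\in[0,1]$ and members $P,Q$ of the family with means $\mu_P,\mu_Q$, $$I_\alpha(P,Q)=\alpha\,\mathrm{KL}(P,M_\alpha)+(1-\alpha)\,\mathrm{KL}(Q,M_\alpha),$$ where $M_\alpha$ is the member of the family with mean $\alpha\mu_P+(1-\alpha)\mu_Q$. -/

import Mathlib

open MeasureTheory ProbabilityTheory
open scoped ENNReal unitInterval Matrix

namespace FeedbackGraph

/-- A canonical one-parameter exponential family of distributions on `ℝ`: for `θ` in the interval
`Θ`, the function `x ↦ exp (θ x - b θ)` is the density, with respect to the dominating measure `ρ`,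
of a probability distribution that has a mean. Normalisation makes `b` the log-partition function
`log ∫ exp (θ x) dρ`, so that `b` is convex on `Θ` and smooth inside `Θ`, and the mean at `θ` is
the derivative of `b` at `θ`. -/
structure ExpFamily where
  ρ : Measure ℝ
  Θ : Set ℝ
  b : ℝ → ℝ
  ordConnected : Θ.OrdConnected
  isProbabilityMeasure : ∀ θ ∈ Θ,
    IsProbabilityMeasure (ρ.withDensity fun x => ENNReal.ofReal (Real.exp (θ * x - b θ)))
  integrable : ∀ θ ∈ Θ,
    Integrable (fun x : ℝ => x) (ρ.withDensity fun x => ENNReal.ofReal (Real.exp (θ * x - b θ)))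

namespace ExpFamily

variable (F : ExpFamily)

/-- The member of the family with canonical parameter `θ`. -/
noncomputable def law (θ : ℝ) : Measure ℝ :=
  F.ρ.withDensity fun x => ENNReal.ofReal (Real.exp (θ * x - F.b θ))

/-- The mean of the member with canonical parameter `θ`. -/
noncomputable def mean (θ : ℝ) : ℝ := ∫ x, x ∂(F.law θ)

/-- A canonical parameter in `Θ` whose mean is `x`. It exists when `x` lies between the means of two
members, and the corresponding member of the family is then unique. -/
noncomputable def paramOfMean (x : ℝ) : ℝ := Function.invFunOn F.mean F.Θ x

/-- The generalised Jensen-Shannon divergence `I_α(P, Q)` of the members `P`, `Q` of the family with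
canonical parameters `θ₁`, `θ₂`: the mixture of `P` and `Q` is the member of the family whose mean
is `α` times the mean of `P` plus `1 - α` times the mean of `Q`. -/
noncomputable def genJS (α θ₁ θ₂ : ℝ) : ℝ≥0∞ :=
  ENNReal.ofReal α * InformationTheory.klDiv (F.law θ₁)
      (F.law (F.paramOfMean (α * F.mean θ₁ + (1 - α) * F.mean θ₂))) +
    ENNReal.ofReal (1 - α) * InformationTheory.klDiv (F.law θ₂)
      (F.law (F.paramOfMean (α * F.mean θ₁ + (1 - α) * F.mean θ₂)))

end ExpFamily

/-- The activation variables `Y (v, u)` and the rewards `R u` of one round. -/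
abbrev Round (K : ℕ) : Type := (Fin K → Fin K → ℝ) × (Fin K → ℝ)

/-- The canonical sample space: the variables of all rounds. Round number `t + 1` is the
coordinate `t`. -/
abbrev Sample (K : ℕ) : Type := ℕ → Round K

/-- A model with `K` vertices: edge probabilities and one member of the family per vertex. -/
structure Model (F : ExpFamily) (K : ℕ) where
  G : Fin K → Fin K → I
  θ : Fin K → ℝ
  θ_mem : ∀ u, θ u ∈ F.Θ

namespace Model

variable {F : ExpFamily} {K : ℕ} (M : Model F K)

/-- The reward distribution of the vertex `u`. -/
noncomputable def reward (u : Fin K) : Measure ℝ := F.law (M.θ u)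

/-- The mean reward of the vertex `u`. -/
noncomputable def mean (u : Fin K) : ℝ := F.mean (M.θ u)

/-- Every vertex has an in-neighbour. -/
def Observable : Prop := ∀ u, ∃ v, 0 < M.G v u

/-- The vertex `a` is the unique best vertex. -/
def IsBest (a : Fin K) : Prop := ∀ u, u ≠ a → M.mean u < M.mean a

/-- The law of one round: all activations `Y (v, u) ∼ Ber (G v u)` and all rewards are
independent. -/
noncomputable def roundLaw : Measure (Round K) :=
  (Measure.pi fun v => Measure.pi fun u => bernoulliMeasure (1 : ℝ) 0 (M.G v u)).prod
    (Measure.pi fun u => M.reward u)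

/-- The law of the whole sequence of rounds, which are independent. -/
noncomputable def prob : Measure (Sample K) := Measure.infinitePi fun _ : ℕ => M.roundLaw

instance (u : Fin K) : IsProbabilityMeasure (M.reward u) :=
  F.isProbabilityMeasure _ (M.θ_mem u)

instance : IsProbabilityMeasure M.roundLaw := by unfold roundLaw; infer_instance

instance : IsProbabilityMeasure M.prob := by unfold prob; infer_instance

/-- The observation rates `m = Gᵀ ω`. -/
noncomputable def rate (ω : Fin K → ℝ) : Fin K → ℝ :=
  (Matrix.of fun v u => (M.G v u : ℝ))ᵀ *ᵥ ω

/-- The information rate, that is the inverse of the characteristic time, where `a` is the best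
vertex. -/
noncomputable def infoRate (a : Fin K) : ℝ≥0∞ :=
  ⨆ ω ∈ stdSimplex ℝ (Fin K), ⨅ u, ⨅ _ : u ≠ a,
    ENNReal.ofReal (M.rate ω u + M.rate ω a) *
      F.genJS (M.rate ω a / (M.rate ω u + M.rate ω a)) (M.θ a) (M.θ u)

/-- The characteristic time. -/
noncomputable def charTime (a : Fin K) : ℝ≥0∞ := (M.infoRate a)⁻¹

end Model

section Learner

variable {K : ℕ}

/-- The observation `Z u = Y (v, u) * R u` in the round `t + 1`, where `v` is the vertex
chosen in that round. -/
def obs (V : ℕ → Sample K → Fin K) (t : ℕ) (ω : Sample K) : Fin K → ℝ :=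
  fun u => (ω t).1 (V t ω) u * (ω t).2 u

/-- The information after `t` rounds: the σ-algebra generated by the chosen vertices and the
observations of the first `t` rounds. -/
@[reducible] def history (V : ℕ → Sample K → Fin K) (t : ℕ) : MeasurableSpace (Sample K) :=
  ⨆ s, ⨆ _ : s < t, MeasurableSpace.comap (V s) inferInstance ⊔
    MeasurableSpace.comap (obs V s) inferInstance

/-- A sampling rule: the vertex chosen in the round `t + 1` depends only on the information after
`t` rounds. -/
structure SamplingRule (K : ℕ) where
  V : ℕ → Sample K → Fin K
  measurable_V : ∀ t, Measurable[history V t] (V t)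

theorem measurable_obs {V : ℕ → Sample K → Fin K} {t : ℕ} (h : Measurable (V t)) :
    Measurable (obs V t) := by
  refine measurable_pi_lambda _ fun u => Measurable.mul ?_ (by fun_prop)
  have h2 : Measurable fun p : Sample K × Fin K => (p.1 t).1 p.2 u :=
    measurable_from_prod_countable_left fun v => by
      have e : Measurable fun r : Round K => r.1 v u :=
        (measurable_pi_apply u).comp ((measurable_pi_apply v).comp measurable_fst)
      exact e.comp (measurable_pi_apply t)
  exact h2.comp (measurable_id.prodMk h)

theorem SamplingRule.history_le (A : SamplingRule K) (t : ℕ) :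
    history A.V t ≤ (inferInstance : MeasurableSpace (Sample K)) := by
  induction t using Nat.strong_induction_on with
  | _ t ih =>
    refine iSup₂_le fun s hs => ?_
    have h : Measurable (A.V s) := (A.measurable_V s).mono (ih s hs) le_rfl
    exact sup_le h.comap_le (measurable_obs h).comap_le

/-- The filtration of the information available to the learner. -/
def SamplingRule.filtration (A : SamplingRule K) :
    Filtration ℕ (inferInstance : MeasurableSpace (Sample K)) where
  seq := history A.V
  mono' _ _ h := biSup_mono fun _ hs => lt_of_lt_of_le hs h
  le' := A.history_le

/-- An algorithm: a sampling rule, a stopping time, and a recommendation that depends only on the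
information available at that time. It does not depend on the model. -/
structure Algorithm (K : ℕ) extends SamplingRule K where
  τ : Sample K → WithTop ℕ
  isStoppingTime : IsStoppingTime toSamplingRule.filtration τ
  recommend : Sample K → Fin K
  measurable_recommend : Measurable[isStoppingTime.measurableSpace] recommend

/-- The algorithm is `δ`-PC: in every observable model of the family with a best vertex, the
probability of stopping with a wrong recommendation is below `δ`. -/
def Algorithm.IsPC (A : Algorithm K) (F : ExpFamily) (δ : ℝ) : Prop :=
  ∀ M : Model F K, M.Observable → ∀ a, M.IsBest a →
    M.prob {ω | A.τ ω < ⊤ ∧ A.recommend ω ≠ a} < ENNReal.ofReal δ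

/-- The expected stopping time under the model `M`. -/
noncomputable def Algorithm.expectedTime {F : ExpFamily} (A : Algorithm K) (M : Model F K) :
    ℝ≥0∞ :=
  ∫⁻ ω, ENat.toENNReal (A.τ ω) ∂M.prob

end Learner

/-- The Bernoulli relative entropy. -/
noncomputable def klBer (x y : ℝ) : ℝ :=
  x * Real.log (x / y) + (1 - x) * Real.log ((1 - x) / (1 - y))

end FeedbackGraph

/-!
The proof is a change of measure. Let `M'` be a model with the graph of `M` and another best vertex
`c ≠ a`. By `δ`-correctness, the event of stopping and recommending `a` has probability above
`1 - δ` under `M` (when the stopping time has finite mean, so that it is almost surely finite) and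
below `δ` under `M'`, so the relative entropy between the two laws of what is seen up to the stopping time is
at least `klBer δ (1 - δ)` (`klBer_le_neg_integral`). On the other hand, this relative entropy is at
most `∑ v, N v * ∑ u, G v u * KL (ν u, ν' u)`, where `N v` is the expected number of choices of `v`
under `M`. Together these are the transportation inequality `Algorithm.klBer_le_of_alternative`.

The upper bound on the relative entropy works on the canonical sample space. Tilting, for each
round before the stopping time, exactly the rewards that the chosen vertex reveals produces a law
that agrees with the law of `M'` on the information of the learner, although it differs from it on
the unrevealed rewards (`SamplingRule.prob_eq_lintegral_logLik`, by induction on the number of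
rounds, as a round is independent of the past, and `Algorithm.prob_eq_lintegral_stoppedLogLik` at
the stopping time). The density is a function of the activations and
rewards, not of the observations, which is enough by data processing.

For a rival `u` and a parameter `s` between those of `u` and `a`, moving both vertices to `s` makes
`a` no longer the unique best vertex, and an arbitrarily small further change makes another vertex
the unique best one (`le_of_forall_alternative`). By continuity of the divergence this gives
`klBer δ (1 - δ) ≤ N_a KL (ν_a, ν_s) + N_u KL (ν_u, ν_s)` with the observation counts `Gᵀ N`
(`Algorithm.klBer_le_pair`). For `s` with the mean of the mixture, the right-hand side is
`E[τ]` times the term of `u` in the information rate at the weights `N / E[τ]`.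
-/

namespace FeedbackGraph

/-! ### Divergence and mean in an exponential family -/

namespace ExpFamily

variable (F : ExpFamily)

/-- The logarithm of the density of the member `s` with respect to the member `θ`. -/
noncomputable def logRatio (θ s x : ℝ) : ℝ := (s - θ) * x - F.b s + F.b θ

/-- The Kullback-Leibler divergence between the members `θ` and `s` in closed form, as a real
number. -/
noncomputable def klReal (θ s : ℝ) : ℝ := (θ - s) * F.mean θ - F.b θ + F.b s

variable {F}

theorem isProbabilityMeasure_law {θ : ℝ} (hθ : θ ∈ F.Θ) : IsProbabilityMeasure (F.law θ) :=
  F.isProbabilityMeasure θ hθ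

theorem integrable_id_law {θ : ℝ} (hθ : θ ∈ F.Θ) : Integrable (fun x : ℝ => x) (F.law θ) :=
  F.integrable θ hθ

@[fun_prop]
theorem measurable_logRatio (θ s : ℝ) : Measurable (F.logRatio θ s) := by
  unfold logRatio; fun_prop

theorem law_eq_withDensity (θ s : ℝ) :
    F.law s = (F.law θ).withDensity fun x => ENNReal.ofReal (Real.exp (F.logRatio θ s x)) := by
  unfold law
  rw [← withDensity_mul _ (by fun_prop) (by fun_prop)]
  congr 1
  ext x
  simp only [Pi.mul_apply, logRatio]
  rw [← ENNReal.ofReal_mul (Real.exp_nonneg _), ← Real.exp_add]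
  congr 2
  ring

theorem law_absolutelyContinuous (θ s : ℝ) : F.law s ≪ F.law θ := by
  rw [law_eq_withDensity θ s]
  exact withDensity_absolutelyContinuous _ _

theorem integral_law (θ s : ℝ) (f : ℝ → ℝ) :
    ∫ x, f x ∂F.law s = ∫ x, Real.exp (F.logRatio θ s x) * f x ∂F.law θ := by
  rw [law_eq_withDensity θ s, integral_withDensity_eq_integral_toReal_smul (by fun_prop) (by simp)]
  simp [ENNReal.toReal_ofReal (Real.exp_nonneg _)]

theorem integrable_law_iff (θ s : ℝ) (f : ℝ → ℝ) :
    Integrable f (F.law s) ↔ Integrable (fun x => Real.exp (F.logRatio θ s x) * f x) (F.law θ) := by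
  rw [law_eq_withDensity θ s,
    integrable_withDensity_iff_integrable_smul' (by fun_prop) (by simp)]
  simp [ENNReal.toReal_ofReal (Real.exp_nonneg _)]

theorem integrable_logRatio {θ : ℝ} (hθ : θ ∈ F.Θ) (s : ℝ) :
    Integrable (F.logRatio θ s) (F.law θ) := by
  have := isProbabilityMeasure_law hθ
  exact (((integrable_id_law hθ).const_mul _).sub (integrable_const _)).add (integrable_const _)

theorem integral_logRatio {θ : ℝ} (hθ : θ ∈ F.Θ) (s : ℝ) :
    ∫ x, F.logRatio θ s x ∂F.law θ = - F.klReal θ s := by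
  have := isProbabilityMeasure_law hθ
  have h1 := (integrable_id_law hθ).const_mul (s - θ)
  calc ∫ x, F.logRatio θ s x ∂F.law θ
      = ∫ x, ((s - θ) * x + (F.b θ - F.b s)) ∂F.law θ := by
        refine integral_congr_ae (ae_of_all _ fun x => ?_)
        simp only [logRatio]
        ring
    _ = (s - θ) * F.mean θ + (F.b θ - F.b s) := by
        rw [integral_add h1 (integrable_const _), integral_const_mul]
        simp [mean]
    _ = - F.klReal θ s := by unfold klReal; ring

theorem klDiv_law {θ s : ℝ} (hθ : θ ∈ F.Θ) (hs : s ∈ F.Θ) :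
    InformationTheory.klDiv (F.law θ) (F.law s) = ENNReal.ofReal (F.klReal θ s) := by
  have := isProbabilityMeasure_law hθ
  have := isProbabilityMeasure_law hs
  have hllr : llr (F.law θ) (F.law s) =ᵐ[F.law θ] fun x => - F.logRatio θ s x := by
    refine (law_absolutelyContinuous s θ).ae_le ?_
    have h := Measure.rnDeriv_withDensity (F.law s)
      (f := fun x => ENNReal.ofReal (Real.exp (F.logRatio s θ x))) (by fun_prop)
    rw [← law_eq_withDensity s θ] at h
    filter_upwards [h] with x hx
    rw [llr, hx, ENNReal.toReal_ofReal (Real.exp_nonneg _), Real.log_exp]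
    unfold logRatio
    ring
  rw [InformationTheory.klDiv_of_ac_of_integrable (law_absolutelyContinuous s θ)
    ((integrable_congr hllr).2 (integrable_logRatio hθ s).neg), integral_congr_ae hllr,
    integral_neg, integral_logRatio hθ]
  simp

theorem klReal_self (θ : ℝ) : F.klReal θ θ = 0 := by simp [klReal]

theorem klReal_nonneg {θ s : ℝ} (hθ : θ ∈ F.Θ) (hs : s ∈ F.Θ) : 0 ≤ F.klReal θ s := by
  have := isProbabilityMeasure_law hθ
  have := isProbabilityMeasure_law hs
  -- Gibbs' inequality: `log p ≤ p - 1` for the density `p` of `s` with respect to `θ`.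
  have h1 : Integrable (fun x => Real.exp (F.logRatio θ s x)) (F.law θ) := by
    simpa using (integrable_law_iff θ s fun _ => 1).1 (integrable_const _)
  have h2 : ∫ x, Real.exp (F.logRatio θ s x) ∂F.law θ = 1 := by
    simpa using (integral_law (F := F) θ s fun _ => 1).symm
  have h3 : ∫ x, F.logRatio θ s x ∂F.law θ ≤ ∫ x, (Real.exp (F.logRatio θ s x) - 1) ∂F.law θ :=
    integral_mono (integrable_logRatio hθ s) (h1.sub (integrable_const _)) fun x => by
      linarith [Real.add_one_le_exp (F.logRatio θ s x)]
  rw [integral_logRatio hθ, integral_sub h1 (integrable_const _), h2] at h3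
  simp only [integral_const, probReal_univ, smul_eq_mul] at h3
  linarith

theorem klReal_add_klReal (θ s : ℝ) :
    F.klReal θ s + F.klReal s θ = (s - θ) * (F.mean s - F.mean θ) := by
  unfold klReal; ring

theorem mean_mono : MonotoneOn F.mean F.Θ := by
  intro θ hθ s hs h
  rcases h.eq_or_lt with rfl | h
  · exact le_rfl
  have h1 := klReal_add_klReal (F := F) θ s
  have h2 := klReal_nonneg hθ hs
  have h3 := klReal_nonneg hs hθ
  by_contra! h4
  nlinarith

/-- Two parameters with the same mean force the whole family to be one point mass, because the
density of one member with respect to the other is then constant. -/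
theorem mean_eq_of_mean_eq {θ s : ℝ} (hθ : θ ∈ F.Θ) (hs : s ∈ F.Θ) (hne : θ ≠ s)
    (h : F.mean θ = F.mean s) : ∃ c, ∀ r ∈ F.Θ, F.mean r = c := by
  have := isProbabilityMeasure_law hθ
  have := isProbabilityMeasure_law hs
  have h1 := klReal_add_klReal (F := F) θ s
  have h2 := klReal_nonneg hθ hs
  have h3 := klReal_nonneg hs hθ
  have h0 : F.klReal θ s = 0 := by rw [h, sub_self, mul_zero] at h1; linarith
  have hlaw : F.law θ = F.law s := by
    rw [← InformationTheory.klDiv_eq_zero_iff, klDiv_law hθ hs, h0, ENNReal.ofReal_zero]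
  have hd : (fun x => ENNReal.ofReal (Real.exp (F.logRatio θ s x))) =ᵐ[F.law θ] fun _ => 1 := by
    refine (withDensity_eq_iff (by fun_prop) (by fun_prop) ?_).1 ?_
    · rw [← setLIntegral_univ, ← withDensity_apply _ MeasurableSet.univ, ← law_eq_withDensity]
      simp
    · rw [← law_eq_withDensity, ← hlaw]
      exact (withDensity_one).symm
  refine ⟨(F.b s - F.b θ) / (s - θ), fun r hr => ?_⟩
  have := isProbabilityMeasure_law hr
  have hc : ∀ᵐ x ∂F.law r, x = (F.b s - F.b θ) / (s - θ) := by
    refine (law_absolutelyContinuous θ r).ae_le ?_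
    filter_upwards [hd] with x hx
    have hx' : F.logRatio θ s x = 0 := by simpa using hx
    rw [eq_div_iff (sub_ne_zero.2 hne.symm)]
    unfold logRatio at hx'
    linarith
  rw [mean, integral_congr_ae hc]
  simp

theorem mean_strictMono {θ₁ θ₂ : ℝ} (h₁ : θ₁ ∈ F.Θ) (h₂ : θ₂ ∈ F.Θ)
    (hne : F.mean θ₁ ≠ F.mean θ₂) : StrictMonoOn F.mean F.Θ := by
  intro θ hθ s hs h
  refine (mean_mono hθ hs h.le).lt_of_ne fun heq => hne ?_
  obtain ⟨c, hc⟩ := mean_eq_of_mean_eq hθ hs h.ne heq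
  rw [hc _ h₁, hc _ h₂]

theorem exp_mul_le_add {d e x : ℝ} (hd : 0 ≤ d) (hde : d ≤ e) :
    Real.exp (d * x) ≤ 1 + Real.exp (e * x) := by
  rcases le_total x 0 with hx | hx
  · have : Real.exp (d * x) ≤ 1 := Real.exp_le_one_iff.2 (mul_nonpos_of_nonneg_of_nonpos hd hx)
    linarith [Real.exp_nonneg (e * x)]
  · have : Real.exp (d * x) ≤ Real.exp (e * x) :=
      Real.exp_le_exp.2 (mul_le_mul_of_nonneg_right hde hx)
    linarith

/-- Up to the end points of an interval of parameters, exponential integrals depend continuously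
on the parameter. -/
theorem continuousOn_integral_exp_mul {p q : ℝ}
    {f : ℝ → ℝ} (hf : Measurable f) (hfp : Integrable f (F.law p)) (hfq : Integrable f (F.law q)) :
    ContinuousOn (fun s => ∫ x, Real.exp ((s - p) * x) * f x ∂F.law p) (Set.Icc p q) := by
  refine continuousOn_of_dominated
    (bound := fun x => |f x| + Real.exp ((q - p) * x) * |f x|) ?_ ?_ ?_ ?_
  · exact fun s _ => by fun_prop
  · refine fun s hs => ae_of_all _ fun x => ?_
    rw [norm_mul, Real.norm_eq_abs, Real.norm_eq_abs, abs_of_nonneg (Real.exp_nonneg _)]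
    have := exp_mul_le_add (x := x) (sub_nonneg.2 hs.1) (sub_le_sub_right hs.2 p)
    nlinarith [abs_nonneg (f x)]
  · refine hfp.abs.add ?_
    have h := ((integrable_law_iff p q f).1 hfq).abs.const_mul (Real.exp (F.b q - F.b p))
    refine h.congr (ae_of_all _ fun x => ?_)
    simp only [abs_mul, Real.abs_exp, ← mul_assoc, ← Real.exp_add, logRatio]
    congr 2
    ring
  · exact ae_of_all _ fun x => by fun_prop

theorem exp_b_sub {p s : ℝ} (hs : s ∈ F.Θ) :
    Real.exp (F.b s - F.b p) = ∫ x, Real.exp ((s - p) * x) * 1 ∂F.law p := by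
  have := isProbabilityMeasure_law hs
  have h : (1 : ℝ) = ∫ x, Real.exp (F.logRatio p s x) * 1 ∂F.law p := by
    rw [← integral_law p s fun _ => (1 : ℝ)]; simp
  have h2 : ∀ x, Real.exp ((s - p) * x) * 1
      = Real.exp (F.b s - F.b p) * (Real.exp (F.logRatio p s x) * 1) := fun x => by
    rw [mul_one, mul_one, ← Real.exp_add, logRatio]; congr 1; ring
  simp_rw [h2]
  rw [integral_const_mul, ← h, mul_one]

theorem continuousOn_b {p q : ℝ} (hp : p ∈ F.Θ) (hq : q ∈ F.Θ) :
    ContinuousOn F.b (Set.Icc p q) := by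
  have := isProbabilityMeasure_law hp
  have := isProbabilityMeasure_law hq
  have hsub : Set.Icc p q ⊆ F.Θ := F.ordConnected.out hp hq
  have h := continuousOn_integral_exp_mul (f := fun _ => 1) (measurable_const)
    (integrable_const (μ := F.law p) _) (integrable_const (μ := F.law q) _)
  have h2 : ContinuousOn (fun s => Real.exp (F.b s - F.b p)) (Set.Icc p q) :=
    h.congr fun s hs => exp_b_sub (hsub hs)
  have h3 := (h2.log fun s _ => (Real.exp_pos _).ne').add_const (F.b p)
  refine h3.congr fun s _ => ?_
  simp

theorem continuousOn_mean {p q : ℝ} (hp : p ∈ F.Θ) (hq : q ∈ F.Θ) :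
    ContinuousOn F.mean (Set.Icc p q) := by
  have h := continuousOn_integral_exp_mul (f := fun x => x) measurable_id
    (integrable_id_law hp) (integrable_id_law hq)
  have h2 : ContinuousOn (fun s => Real.exp (F.b p - F.b s)) (Set.Icc p q) :=
    Real.continuous_exp.comp_continuousOn (continuousOn_const.sub (continuousOn_b hp hq))
  refine (h2.mul h).congr fun s _ => ?_
  rw [mean, integral_law p s]
  simp only [Pi.mul_apply]
  rw [← integral_const_mul]
  refine integral_congr_ae (ae_of_all _ fun x => ?_)
  simp only [← mul_assoc, ← Real.exp_add, logRatio]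
  congr 2
  ring

theorem continuousOn_klReal {p q : ℝ} (hp : p ∈ F.Θ) (hq : q ∈ F.Θ) (θ : ℝ) :
    ContinuousOn (fun s => F.klReal θ s) (Set.Icc p q) := by
  have := continuousOn_b hp hq
  unfold klReal
  fun_prop

/-- The parameter of a convex combination of two means lies between the two parameters. -/
theorem paramOfMean_spec {p q : ℝ} (hp : p ∈ F.Θ) (hq : q ∈ F.Θ) (hlt : F.mean p < F.mean q)
    {x : ℝ} (hx : x ∈ Set.Icc (F.mean p) (F.mean q)) :
    F.paramOfMean x ∈ Set.Icc p q := by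
  have hmono := mean_strictMono hp hq hlt.ne
  have hpq : p ≤ q := ((hmono.lt_iff_lt hp hq).1 hlt).le
  obtain ⟨s, hs, hsx⟩ := intermediate_value_Icc hpq (continuousOn_mean hp hq) hx
  have hex : ∃ r ∈ F.Θ, F.mean r = x := ⟨s, F.ordConnected.out hp hq hs, hsx⟩
  have hmem : F.paramOfMean x ∈ F.Θ := Function.invFunOn_mem hex
  have heq : F.mean (F.paramOfMean x) = x := Function.invFunOn_eq hex
  exact ⟨(hmono.le_iff_le hp hmem).1 (hx.1.trans_eq heq.symm),
    (hmono.le_iff_le hmem hq).1 (heq.trans_le hx.2)⟩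

end ExpFamily

/-! ### One round -/

theorem pi_withDensity_prod {ι : Type*} [Fintype ι] {α : ι → Type*} [∀ i, MeasurableSpace (α i)]
    (μ : ∀ i, Measure (α i)) [∀ i, IsProbabilityMeasure (μ i)] {f : ∀ i, α i → ℝ≥0∞}
    (hf : ∀ i, Measurable (f i)) [∀ i, SigmaFinite ((μ i).withDensity (f i))] :
    (Measure.pi μ).withDensity (fun x => ∏ i, f i (x i)) =
      Measure.pi fun i => (μ i).withDensity (f i) := by
  classical
  refine (Measure.pi_eq fun s hs => ?_).symm
  have hind : ∀ x : ∀ i, α i, (Set.univ.pi s).indicator (fun x => ∏ i, f i (x i)) x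
      = ∏ i, (s i).indicator (f i) (x i) := by
    intro x
    by_cases hx : x ∈ Set.univ.pi s
    · rw [Set.indicator_of_mem hx]
      exact Finset.prod_congr rfl fun i _ => (Set.indicator_of_mem (hx i trivial) _).symm
    · rw [Set.indicator_of_notMem hx]
      simp only [Set.mem_pi, Set.mem_univ, true_implies, not_forall] at hx
      obtain ⟨i, hi⟩ := hx
      exact (Finset.prod_eq_zero (Finset.mem_univ i) (Set.indicator_of_notMem hi _)).symm
  rw [withDensity_apply _ (MeasurableSet.univ_pi hs),
    ← lintegral_indicator (MeasurableSet.univ_pi hs)]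
  simp_rw [hind]
  have hm : ∀ i, Measurable ((s i).indicator (f i)) := fun i => (hf i).indicator (hs i)
  have hprod := lintegral_prod_eq_prod_lintegral_of_indepFun (μ := Measure.pi μ) Finset.univ
    (fun i (x : ∀ i, α i) => (s i).indicator (f i) (x i))
    (iIndepFun_pi fun i => (hm i).aemeasurable)
    (fun i => (hm i).comp (measurable_pi_apply i))
  rw [hprod]
  refine Finset.prod_congr rfl fun i _ => ?_
  rw [withDensity_apply _ (hs i), ← lintegral_indicator (hs i),
    ← (measurePreserving_eval μ i).lintegral_comp (hm i)]

namespace Model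

variable {F : ExpFamily} {K : ℕ}

/-- The log-likelihood ratio of `M'` against `M` of the rewards that the choice of the vertex `v`
reveals in one round. The two models are meant to share their graph. -/
noncomputable def roundLogRatio (M M' : Model F K) (v : Fin K) (r : Round K) : ℝ :=
  ∑ u, if r.1 v u = 0 then 0 else F.logRatio (M.θ u) (M'.θ u) (r.2 u)

@[fun_prop]
theorem measurable_roundLogRatio (M M' : Model F K) (v : Fin K) :
    Measurable (M.roundLogRatio M' v) := by
  unfold roundLogRatio
  refine Finset.measurable_sum _ fun u _ => Measurable.ite ?_ measurable_const (by fun_prop)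
  have : Measurable fun r : Round K => r.1 v u := by fun_prop
  exact this (measurableSet_singleton 0)

/-- The observation made in one round by choosing `v`. -/
def roundObs (v : Fin K) (r : Round K) : Fin K → ℝ := fun u => r.1 v u * r.2 u

@[fun_prop]
theorem measurable_roundObs (v : Fin K) : Measurable (roundObs v) := by
  unfold roundObs; fun_prop

/-- Given the activations, tilting only the revealed rewards gives the observation the law that it
has in the other model: an unrevealed coordinate of the observation vanishes in both models. -/
theorem map_withDensity_rewards (M M' : Model F K) (y : Fin K → ℝ) :
    ((Measure.pi M.reward).withDensity fun r => ENNReal.ofReal (Real.exp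
        (∑ u, if y u = 0 then 0 else F.logRatio (M.θ u) (M'.θ u) (r u)))).map
        (fun r u => y u * r u)
      = (Measure.pi M'.reward).map fun r u => y u * r u := by
  have hprod : (fun r : Fin K → ℝ => ENNReal.ofReal (Real.exp
        (∑ u, if y u = 0 then 0 else F.logRatio (M.θ u) (M'.θ u) (r u))))
      = fun r => ∏ u, (fun x => ENNReal.ofReal (Real.exp
        (if y u = 0 then 0 else F.logRatio (M.θ u) (M'.θ u) x))) (r u) := by
    ext r
    rw [Real.exp_sum, ENNReal.ofReal_prod_of_nonneg fun _ _ => Real.exp_nonneg _]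
  have hd : ∀ u, (M.reward u).withDensity (fun x => ENNReal.ofReal (Real.exp
        (if y u = 0 then 0 else F.logRatio (M.θ u) (M'.θ u) x)))
      = if y u = 0 then M.reward u else M'.reward u := by
    intro u
    by_cases h : y u = 0
    · simp [h]
    · simp only [h, if_false]
      exact (F.law_eq_withDensity _ _).symm
  have hp : ∀ u, IsProbabilityMeasure ((M.reward u).withDensity (fun x => ENNReal.ofReal (Real.exp
        (if y u = 0 then 0 else F.logRatio (M.θ u) (M'.θ u) x)))) := by
    intro u
    rw [hd u]
    split_ifs <;> infer_instance
  have hm : ∀ u, Measurable fun x : ℝ => y u * x := fun u => by fun_prop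
  rw [hprod, pi_withDensity_prod M.reward (f := fun u x => ENNReal.ofReal (Real.exp
        (if y u = 0 then 0 else F.logRatio (M.θ u) (M'.θ u) x)))]
  · rw [Measure.pi_map_pi fun u => (hm u).aemeasurable,
      Measure.pi_map_pi fun u => (hm u).aemeasurable]
    congr 1
    ext1 u
    rw [hd u]
    split_ifs with h
    · simp [h, Measure.map_const]
    · rfl
  · intro u
    by_cases h : y u = 0
    · simp [h]
    · simp only [h, if_false]
      fun_prop

theorem lintegral_roundLaw_tilt (M M' : Model F K) (hG : M'.G = M.G) (v : Fin K)
    {B : Set (Fin K → ℝ)} (hB : MeasurableSet B) :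
    ∫⁻ r in roundObs v ⁻¹' B, ENNReal.ofReal (Real.exp (M.roundLogRatio M' v r)) ∂M.roundLaw
      = M'.roundLaw (roundObs v ⁻¹' B) := by
  have hB' : MeasurableSet (roundObs v ⁻¹' B) := measurable_roundObs v hB
  rw [← lintegral_indicator hB']
  unfold roundLaw
  rw [lintegral_prod _ (Measurable.aemeasurable ((by fun_prop : Measurable fun r =>
    ENNReal.ofReal (Real.exp (M.roundLogRatio M' v r))).indicator hB')),
    Measure.prod_apply hB', hG]
  refine lintegral_congr fun y => ?_
  have h := congrArg (fun μ : Measure (Fin K → ℝ) => μ B) (map_withDensity_rewards M M' (y v))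
  have hm : Measurable fun (r : Fin K → ℝ) u => y v u * r u := by fun_prop
  simp only [Measure.map_apply hm hB] at h
  rw [withDensity_apply _ (hm hB), ← lintegral_indicator (hm hB)] at h
  exact h

/-- The choice of `v` reveals the reward of `u` with probability `G v u`, independently of its
value. -/
theorem integrable_revealed (M M' : Model F K) (v u : Fin K) :
    Integrable (fun r : Round K =>
      if r.1 v u = 0 then 0 else F.logRatio (M.θ u) (M'.θ u) (r.2 u)) M.roundLaw ∧
    ∫ r, (if r.1 v u = 0 then 0 else F.logRatio (M.θ u) (M'.θ u) (r.2 u)) ∂M.roundLaw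
      = - ((M.G v u : ℝ) * F.klReal (M.θ u) (M'.θ u)) := by
  have hl : Integrable (F.logRatio (M.θ u) (M'.θ u)) (M.reward u) :=
    F.integrable_logRatio (M.θ_mem u) _
  let f : ℝ → ℝ := Set.indicator {0}ᶜ 1
  have hf : Measurable f := measurable_one.indicator (measurableSet_singleton 0).compl
  have hfi : ∀ p : I, Integrable f (bernoulliMeasure (1 : ℝ) 0 p) := fun p =>
    (integrable_const (1 : ℝ)).indicator (measurableSet_singleton 0).compl
  have hfv : ∀ p : I, ∫ x, f x ∂(bernoulliMeasure (1 : ℝ) 0 p) = p := fun p => by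
    rw [integral_indicator_one (measurableSet_singleton 0).compl,
      bernoulliMeasure_real_apply_of_mem_of_notMem _ (measurableSet_singleton 0).compl
        (by simp) (by simp)]
  have he : (fun r : Round K =>
      if r.1 v u = 0 then 0 else F.logRatio (M.θ u) (M'.θ u) (r.2 u))
      = fun r => f (r.1 v u) * F.logRatio (M.θ u) (M'.θ u) (r.2 u) := by
    ext r
    by_cases h : r.1 v u = 0 <;> simp [f, h]
  rw [he]
  unfold roundLaw
  have h1 : Integrable (fun y : Fin K → Fin K → ℝ => f (y v u))
      (Measure.pi fun v => Measure.pi fun u => bernoulliMeasure (1 : ℝ) 0 (M.G v u)) :=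
    integrable_comp_eval (i := v) (X := fun _ => Fin K → ℝ)
      (μ := fun v => Measure.pi fun u => bernoulliMeasure (1 : ℝ) 0 (M.G v u))
      (f := fun z : Fin K → ℝ => f (z u))
      (integrable_comp_eval (i := u) (X := fun _ => ℝ)
        (μ := fun u => bernoulliMeasure (1 : ℝ) 0 (M.G v u)) (hfi _))
  have h2 : ∫ y : Fin K → Fin K → ℝ, f (y v u)
      ∂(Measure.pi fun v => Measure.pi fun u => bernoulliMeasure (1 : ℝ) 0 (M.G v u))
      = M.G v u := by
    rw [integral_comp_eval (i := v) (X := fun _ => Fin K → ℝ)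
      (μ := fun v => Measure.pi fun u => bernoulliMeasure (1 : ℝ) 0 (M.G v u))
      (f := fun z : Fin K → ℝ => f (z u))
      (hf.comp (measurable_pi_apply u)).aestronglyMeasurable,
      integral_comp_eval (i := u) (X := fun _ => ℝ)
      (μ := fun u => bernoulliMeasure (1 : ℝ) 0 (M.G v u)) hf.aestronglyMeasurable, hfv]
  refine ⟨h1.mul_prod (integrable_comp_eval (i := u) hl), ?_⟩
  rw [integral_prod_mul (fun y : Fin K → Fin K → ℝ => f (y v u))
    (fun r : Fin K → ℝ => F.logRatio (M.θ u) (M'.θ u) (r u)), h2,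
    integral_comp_eval (i := u) (by fun_prop)]
  have := F.integral_logRatio (M.θ_mem u) (M'.θ u)
  unfold reward
  rw [this]
  ring

theorem integrable_roundLogRatio (M M' : Model F K) (v : Fin K) :
    Integrable (M.roundLogRatio M' v) M.roundLaw :=
  integrable_finsetSum _ fun u _ => (M.integrable_revealed M' v u).1

theorem integral_roundLogRatio (M M' : Model F K) (v : Fin K) :
    ∫ r, M.roundLogRatio M' v r ∂M.roundLaw
      = - ∑ u, (M.G v u : ℝ) * F.klReal (M.θ u) (M'.θ u) := by
  unfold roundLogRatio
  rw [integral_finsetSum _ fun u _ => (M.integrable_revealed M' v u).1, ← Finset.sum_neg_distrib]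
  exact Finset.sum_congr rfl fun u _ => (M.integrable_revealed M' v u).2

end Model

/-! ### Independence of the rounds -/

section Past

variable {F : ExpFamily} {K : ℕ}

/-- The σ-algebra of everything that happens in the first `t` rounds, observed or not. -/
@[reducible] def past (K t : ℕ) : MeasurableSpace (Sample K) :=
  ⨆ s ∈ Set.Iio t, MeasurableSpace.comap (fun x : Sample K => x s) inferInstance

theorem past_le (t : ℕ) : past K t ≤ (inferInstance : MeasurableSpace (Sample K)) :=
  iSup₂_le fun s _ => (measurable_pi_apply s).comap_le

theorem past_mono {s t : ℕ} (h : s ≤ t) : past K s ≤ past K t :=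
  biSup_mono fun _ hr => lt_of_lt_of_le hr h

theorem measurable_past_eval {s t : ℕ} (h : s < t) :
    Measurable[past K t] fun x : Sample K => x s :=
  Measurable.mono (comap_measurable _)
    (le_iSup₂_of_le (f := fun s _ => MeasurableSpace.comap (fun x : Sample K => x s) inferInstance)
      s h le_rfl) le_rfl

/-- A finite-valued choice may be substituted for a parameter without losing measurability. -/
theorem measurable_choice {Ω β : Type*} {m : MeasurableSpace Ω} [MeasurableSpace β]
    {V : Ω → Fin K} (hV : Measurable V) {X : Ω → Round K} (hX : Measurable X)
    {g : Fin K → Round K → β} (hg : ∀ v, Measurable (g v)) :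
    Measurable fun x => g (V x) (X x) := by
  have h : Measurable fun p : Round K × Fin K => g p.2 p.1 :=
    measurable_from_prod_countable_left hg
  exact h.comp (hX.prodMk hV)

theorem SamplingRule.history_le_past (A : SamplingRule K) (t : ℕ) : history A.V t ≤ past K t := by
  induction t using Nat.strong_induction_on with
  | _ t ih =>
    refine iSup₂_le fun s hs => ?_
    have h : Measurable[past K t] (A.V s) :=
      (A.measurable_V s).mono ((ih s hs).trans (past_mono hs.le)) le_rfl
    refine sup_le h.comap_le (Measurable.comap_le ?_)
    exact measurable_choice h (measurable_past_eval hs) Model.measurable_roundObs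

theorem SamplingRule.measurable_past_V (A : SamplingRule K) {s t : ℕ} (h : s ≤ t) :
    Measurable[past K t] (A.V s) :=
  (A.measurable_V s).mono ((A.history_le_past s).trans (past_mono h)) le_rfl

theorem SamplingRule.measurable_V' (A : SamplingRule K) (s : ℕ) : Measurable (A.V s) :=
  (A.measurable_V s).mono (A.history_le s) le_rfl

theorem Model.indep_past (M : Model F K) (t : ℕ) :
    Indep (past K t) (MeasurableSpace.comap (fun x : Sample K => x t) inferInstance) M.prob := by
  have h : iIndepFun (fun (i : ℕ) (x : Sample K) => x i) M.prob :=
    iIndepFun_infinitePi (X := fun _ x => x) fun _ => measurable_id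
  have h2 := indep_iSup_of_disjoint (fun i => (measurable_pi_apply i).comap_le) h.iIndep
    (S := Set.Iio t) (T := {t}) (by simp)
  simpa [past] using h2

theorem Model.measurePreserving_eval (M : Model F K) (t : ℕ) :
    MeasurePreserving (fun x : Sample K => x t) M.prob M.roundLaw :=
  measurePreserving_eval_infinitePi _ t

theorem Model.lintegral_past_mul (M : Model F K) (t : ℕ) {f : Sample K → ℝ≥0∞}
    (hf : Measurable[past K t] f) {g : Round K → ℝ≥0∞} (hg : Measurable g) :
    ∫⁻ x, f x * g (x t) ∂M.prob = (∫⁻ x, f x ∂M.prob) * ∫⁻ r, g r ∂M.roundLaw := by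
  rw [← (M.measurePreserving_eval t).lintegral_comp hg]
  exact lintegral_mul_eq_lintegral_mul_lintegral_of_independent_measurableSpace (past_le t)
    (measurable_pi_apply t).comap_le (M.indep_past t) hf (hg.comp (comap_measurable _))

theorem Model.setIntegral_past (M : Model F K) (t : ℕ) {B : Set (Sample K)}
    (hB : MeasurableSet[past K t] B) {g : Round K → ℝ} (hg : Measurable g) :
    ∫ x in B, g (x t) ∂M.prob = M.prob.real B * ∫ r, g r ∂M.roundLaw := by
  have hB' := past_le t _ hB
  have hf : Measurable[past K t] (B.indicator (1 : Sample K → ℝ)) :=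
    Measurable.indicator (f := fun _ => (1 : ℝ)) measurable_const hB
  have hind : IndepFun (B.indicator (1 : Sample K → ℝ)) (fun x : Sample K => g (x t)) M.prob := by
    rw [IndepFun_iff_Indep]
    refine indep_of_indep_of_le_left (indep_of_indep_of_le_right (M.indep_past t) ?_) hf.comap_le
    exact (hg.comp (comap_measurable _)).comap_le
  have h := hind.integral_fun_mul_eq_mul_integral
    (measurable_one.indicator hB').aestronglyMeasurable
    (hg.comp (measurable_pi_apply t)).aestronglyMeasurable
  rw [integral_indicator_one hB'] at h
  rw [← (M.measurePreserving_eval t).map_eq, integral_map (measurable_pi_apply t).aemeasurable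
    hg.aestronglyMeasurable, ← h,
    ← integral_indicator hB']
  refine integral_congr_ae (ae_of_all _ fun x => ?_)
  by_cases hx : x ∈ B <;> simp [hx]

end Past

/-! ### Change of measure on the information of the learner -/

section ChangeOfMeasure

variable {F : ExpFamily} {K : ℕ} (A : SamplingRule K) (M M' : Model F K)

/-- The log-likelihood ratio of `M'` against `M` of what is revealed in the first `t` rounds. -/
noncomputable def SamplingRule.logLik (t : ℕ) (x : Sample K) : ℝ :=
  ∑ s ∈ Finset.range t, M.roundLogRatio M' (A.V s x) (x s)

theorem SamplingRule.measurable_past_logLik (t : ℕ) :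
    Measurable[past K t] (A.logLik M M' t) := by
  unfold logLik
  refine @Finset.measurable_sum _ _ _ _ _ _ (past K t) _ _ fun s hs => ?_
  have hs' := Finset.mem_range.1 hs
  exact measurable_choice (A.measurable_past_V hs'.le) (measurable_past_eval hs')
    (M.measurable_roundLogRatio M')

theorem isPiSystem_image2_inter {Ω : Type*} (m₁ m₂ : MeasurableSpace Ω) :
    IsPiSystem (Set.image2 (· ∩ ·) {s | MeasurableSet[m₁] s} {s | MeasurableSet[m₂] s}) := by
  rintro _ ⟨s, hs, t, ht, rfl⟩ _ ⟨s', hs', t', ht', rfl⟩ -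
  exact ⟨s ∩ s', MeasurableSet.inter hs hs', t ∩ t', MeasurableSet.inter ht ht',
    Set.inter_inter_inter_comm _ _ _ _⟩

theorem sup_eq_generateFrom_image2_inter {Ω : Type*} (m₁ m₂ : MeasurableSpace Ω) :
    m₁ ⊔ m₂ = MeasurableSpace.generateFrom
      (Set.image2 (· ∩ ·) {s | MeasurableSet[m₁] s} {s | MeasurableSet[m₂] s}) := by
  refine le_antisymm (sup_le ?_ ?_) (MeasurableSpace.generateFrom_le ?_)
  · exact fun s hs => MeasurableSpace.measurableSet_generateFrom
      ⟨s, hs, Set.univ, MeasurableSet.univ, Set.inter_univ _⟩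
  · exact fun s hs => MeasurableSpace.measurableSet_generateFrom
      ⟨Set.univ, MeasurableSet.univ, s, hs, Set.univ_inter _⟩
  · rintro _ ⟨s, hs, t, ht, rfl⟩
    exact MeasurableSet.inter ((le_sup_left : m₁ ≤ m₁ ⊔ m₂) _ hs)
      ((le_sup_right : m₂ ≤ m₁ ⊔ m₂) _ ht)

theorem SamplingRule.history_succ (t : ℕ) : history A.V (t + 1) =
    history A.V t ⊔ MeasurableSpace.comap (obs A.V t) inferInstance := by
  unfold history
  rw [Nat.iSup_lt_succ, ← sup_assoc, sup_eq_left.2 (A.measurable_V t).comap_le]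

/-- The change of measure: on the information after `t` rounds, the model `M'` has the density
`exp (logLik t)` with respect to `M`. The density itself is not a function of the information,
since it reads the activations, and need not be. -/
theorem SamplingRule.prob_eq_lintegral_logLik (hG : M'.G = M.G) (t : ℕ) {B : Set (Sample K)}
    (hB : MeasurableSet[history A.V t] B) :
    M'.prob B = ∫⁻ x in B, ENNReal.ofReal (Real.exp (A.logLik M M' t x)) ∂M.prob := by
  induction t generalizing B with
  | zero =>
    have h0 : history A.V 0 = ⊥ := by simp [history]
    rw [h0, MeasurableSpace.measurableSet_bot_iff] at hB
    rcases hB with rfl | rfl <;> simp [logLik]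
  | succ t ih =>
    -- The identity on the generating sets `s ∩ {obs t ∈ C}`, split by the vertex chosen.
    have key : ∀ s, MeasurableSet[history A.V t] s → ∀ C : Set (Fin K → ℝ), MeasurableSet C →
        M'.prob (s ∩ obs A.V t ⁻¹' C) = ∫⁻ x in s ∩ obs A.V t ⁻¹' C,
          ENNReal.ofReal (Real.exp (A.logLik M M' (t + 1) x)) ∂M.prob := by
      intro s hs C hC
      have hobs : Measurable (obs A.V t) := measurable_obs (A.measurable_V' t)
      have hpiece : ∀ v, MeasurableSet[history A.V t] (s ∩ A.V t ⁻¹' {v}) := fun v =>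
        MeasurableSet.inter hs (A.measurable_V t (measurableSet_singleton v))
      have hU : s ∩ obs A.V t ⁻¹' C
          = ⋃ v, (s ∩ A.V t ⁻¹' {v}) ∩ (fun x => x t) ⁻¹' (Model.roundObs v ⁻¹' C) := by
        ext x
        simp only [Set.mem_inter_iff, Set.mem_preimage, Set.mem_iUnion, Set.mem_singleton_iff]
        constructor
        · exact fun h => ⟨A.V t x, ⟨h.1, rfl⟩, h.2⟩
        · rintro ⟨v, ⟨h1, rfl⟩, h2⟩
          exact ⟨h1, h2⟩
      have hC' : ∀ v, MeasurableSet (Model.roundObs v ⁻¹' C) := fun v =>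
        Model.measurable_roundObs v hC
      have hmeas : ∀ v, MeasurableSet
          ((s ∩ A.V t ⁻¹' {v}) ∩ (fun x => x t) ⁻¹' (Model.roundObs v ⁻¹' C)) := fun v =>
        (A.history_le t _ (hpiece v)).inter (measurable_pi_apply t (hC' v))
      have hdisj : Pairwise (Function.onFun Disjoint fun v =>
          (s ∩ A.V t ⁻¹' {v}) ∩ (fun x : Sample K => x t) ⁻¹' (Model.roundObs v ⁻¹' C)) := by
        intro v w hvw
        refine Set.disjoint_left.2 fun x hx hx' => hvw ?_
        exact hx.1.2.symm.trans hx'.1.2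
      rw [hU, measure_iUnion hdisj hmeas, lintegral_iUnion hmeas hdisj]
      refine tsum_congr fun v => ?_
      have hp := A.history_le_past t _ (hpiece v)
      have hp' := past_le t _ hp
      have h1 := M'.lintegral_past_mul t
        (f := (s ∩ A.V t ⁻¹' {v}).indicator 1)
        (Measurable.indicator (f := fun _ => (1 : ℝ≥0∞)) measurable_const hp)
        (g := (Model.roundObs v ⁻¹' C).indicator 1)
        (Measurable.indicator (f := fun _ => (1 : ℝ≥0∞)) measurable_const (hC' v))
      have h2 := M.lintegral_past_mul t
        (f := (s ∩ A.V t ⁻¹' {v}).indicator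
          fun x => ENNReal.ofReal (Real.exp (A.logLik M M' t x)))
        (Measurable.indicator (ENNReal.measurable_ofReal.comp
          (Real.measurable_exp.comp (A.measurable_past_logLik M M' t))) hp)
        (g := (Model.roundObs v ⁻¹' C).indicator
          fun r => ENNReal.ofReal (Real.exp (M.roundLogRatio M' v r)))
        (Measurable.indicator (by fun_prop) (hC' v))
      rw [lintegral_indicator hp', ← ih (hpiece v), lintegral_indicator (hC' v),
        M.lintegral_roundLaw_tilt M' hG v hC] at h2
      rw [lintegral_indicator_one hp', lintegral_indicator_one (hC' v), ← h2] at h1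
      rw [← lintegral_indicator_one (hmeas v)]
      trans
      · refine Eq.trans (lintegral_congr fun x => ?_) h1
        simp only [Set.indicator, Set.mem_inter_iff, Set.mem_preimage, Pi.one_apply]
        split_ifs <;> simp_all
      · rw [← lintegral_indicator (hmeas v)]
        refine lintegral_congr fun x => ?_
        by_cases hx1 : x ∈ s ∩ A.V t ⁻¹' {v}
        · by_cases hx2 : x t ∈ Model.roundObs v ⁻¹' C
          · have hv : A.V t x = v := hx1.2
            rw [Set.indicator_of_mem hx1, Set.indicator_of_mem hx2,
              Set.indicator_of_mem (Set.mem_inter hx1 hx2),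
              ← ENNReal.ofReal_mul (Real.exp_nonneg _), ← Real.exp_add]
            simp only [logLik, Finset.sum_range_succ, hv]
          · rw [Set.indicator_of_notMem hx2, mul_zero,
              Set.indicator_of_notMem fun h => hx2 h.2]
        · rw [Set.indicator_of_notMem hx1, zero_mul, Set.indicator_of_notMem fun h => hx1 h.1]
    have hle := A.history_le (t + 1)
    have huniv := key Set.univ MeasurableSet.univ Set.univ MeasurableSet.univ
    simp only [Set.preimage_univ, Set.inter_univ] at huniv
    rw [← withDensity_apply _ (hle _ hB)]
    refine ext_on_measurableSpace_of_generate_finite _ _ ?_ hle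
      ((A.history_succ t).trans (sup_eq_generateFrom_image2_inter _ _))
      (isPiSystem_image2_inter _ _) ?_ hB
    · rintro _ ⟨s, hs, _, ⟨C, hC, rfl⟩, rfl⟩
      have hm : MeasurableSet (s ∩ obs A.V t ⁻¹' C) :=
        (A.history_le t _ hs).inter (measurable_obs (A.measurable_V' t) hC)
      rw [withDensity_apply _ hm]
      exact key s hs C hC
    · rw [withDensity_apply _ MeasurableSet.univ]
      exact huniv

end ChangeOfMeasure

/-! ### Relative entropy up to the stopping time -/

/-- The data-processing inequality for the relative entropy and one event: a density `exp L` that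
moves the mass of an event from at least `1 - δ` to at most `δ` costs at least the Bernoulli
relative entropy. -/
theorem klBer_le_neg_integral {Ω : Type*} [MeasurableSpace Ω] {μ : Measure Ω}
    [IsProbabilityMeasure μ] {L : Ω → ℝ} (hL : Measurable L) (hLi : Integrable L μ)
    {E : Set Ω} (hE : MeasurableSet E) {δ : ℝ} (hδ : 0 < δ) (hδ' : δ ≤ 1 / 2)
    (hone : ∫⁻ x, ENNReal.ofReal (Real.exp (L x)) ∂μ = 1)
    (hq : ∫⁻ x in E, ENNReal.ofReal (Real.exp (L x)) ∂μ ≤ ENNReal.ofReal δ)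
    (hp : ENNReal.ofReal (1 - δ) ≤ μ E) :
    klBer δ (1 - δ) ≤ - ∫ x, L x ∂μ := by
  have hexp : Measurable fun x => Real.exp (L x) := by fun_prop
  have hint : Integrable (fun x => Real.exp (L x)) μ := by
    refine ⟨hexp.aestronglyMeasurable, ?_⟩
    rw [hasFiniteIntegral_iff_ofReal (ae_of_all _ fun _ => Real.exp_nonneg _), hone]
    exact ENNReal.one_lt_top
  have h1 : ∫ x, Real.exp (L x) ∂μ = 1 := by
    rw [integral_eq_lintegral_of_nonneg_ae (ae_of_all _ fun _ => Real.exp_nonneg _)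
      hexp.aestronglyMeasurable, hone, ENNReal.toReal_one]
  have h2 : ∫ x in E, Real.exp (L x) ∂μ ≤ δ := by
    rw [integral_eq_lintegral_of_nonneg_ae (ae_of_all _ fun _ => Real.exp_nonneg _)
      hexp.aestronglyMeasurable]
    exact ENNReal.toReal_le_of_le_ofReal hδ.le hq
  have h3 : 1 - δ ≤ μ.real E :=
    (ENNReal.ofReal_le_iff_le_toReal (measure_ne_top _ _)).1 hp
  have hsum := integral_add_compl hE hint
  have hLsum := integral_add_compl hE hLi
  have hμ : μ.real Eᶜ = 1 - μ.real E := probReal_compl_eq_one_sub hE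
  set r := (1 - δ) / δ with hr
  have hr1 : 1 ≤ r := by rw [hr, le_div_iff₀ hδ]; linarith
  have hr0 : 0 < r := by linarith
  have hlog : 0 ≤ Real.log r := Real.log_nonneg hr1
  -- `log z ≤ z - 1` at `z = r * exp L` on `E` and at `z = r⁻¹ * exp L` off `E`.
  have hA : ∫ x in E, L x ∂μ ≤ ∫ x in E, (r * Real.exp (L x) - (1 + Real.log r)) ∂μ := by
    refine setIntegral_mono hLi.integrableOn
      ((hint.const_mul r).sub (integrable_const _)).integrableOn fun x => ?_
    have := Real.log_le_sub_one_of_pos (mul_pos hr0 (Real.exp_pos (L x)))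
    rw [Real.log_mul hr0.ne' (Real.exp_ne_zero _), Real.log_exp] at this
    linarith
  have hB : ∫ x in Eᶜ, L x ∂μ ≤ ∫ x in Eᶜ, (r⁻¹ * Real.exp (L x) - (1 - Real.log r)) ∂μ := by
    refine setIntegral_mono hLi.integrableOn
      ((hint.const_mul r⁻¹).sub (integrable_const _)).integrableOn fun x => ?_
    have := Real.log_le_sub_one_of_pos (mul_pos (inv_pos.2 hr0) (Real.exp_pos (L x)))
    rw [Real.log_mul (inv_pos.2 hr0).ne' (Real.exp_ne_zero _), Real.log_exp, Real.log_inv] at this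
    linarith
  rw [integral_sub (hint.const_mul r).integrableOn (integrable_const _), integral_const_mul,
    setIntegral_const, smul_eq_mul] at hA
  rw [integral_sub (hint.const_mul r⁻¹).integrableOn (integrable_const _), integral_const_mul,
    setIntegral_const, smul_eq_mul, hμ] at hB
  have hkl : klBer δ (1 - δ) = (1 - 2 * δ) * Real.log r := by
    have : Real.log (δ / (1 - δ)) = - Real.log r := by rw [hr, ← Real.log_inv, inv_div]
    simp only [klBer, sub_sub_cancel, this, ← hr]
    ring
  have hδ1 : 0 < 1 - δ := by linarith
  have hrδ : r * δ = 1 - δ := by rw [hr]; field_simp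
  have hrδ' : r⁻¹ * (1 - δ) = δ := by rw [hr]; field_simp
  have hri : r⁻¹ ≤ r := (inv_le_one_of_one_le₀ hr1).trans hr1
  set q := ∫ x in E, Real.exp (L x) ∂μ
  have hqc : ∫ x in Eᶜ, Real.exp (L x) ∂μ = 1 - q := by linarith
  rw [hqc] at hB
  have hm1 : (r - r⁻¹) * q ≤ (r - r⁻¹) * δ := mul_le_mul_of_nonneg_left h2 (by linarith)
  have hm2 : (1 - δ) * Real.log r ≤ μ.real E * Real.log r := mul_le_mul_of_nonneg_right h3 hlog
  rw [hkl]
  nlinarith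

theorem measure_eq_sum_stopping {Ω : Type*} [MeasurableSpace Ω] (μ : Measure Ω)
    {τ : Ω → WithTop ℕ} (hτ : ∀ t : ℕ, MeasurableSet {x | τ x = t}) (n : ℕ) (B : Set Ω) :
    μ B = ∑ t ∈ Finset.range n, μ (B ∩ {x | τ x = t}) + μ (B ∩ {x | (n : WithTop ℕ) ≤ τ x}) := by
  induction n with
  | zero => simp
  | succ n ih =>
    have h1 : B ∩ {x | (n : WithTop ℕ) ≤ τ x} ∩ {x | τ x = n} = B ∩ {x | τ x = n} := by
      ext x
      simp only [Set.mem_inter_iff, Set.mem_ofPred_eq]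
      exact ⟨fun h => ⟨h.1.1, h.2⟩, fun h => ⟨⟨h.1, h.2.ge⟩, h.2⟩⟩
    have h2 : (B ∩ {x | (n : WithTop ℕ) ≤ τ x}) \ {x | τ x = n}
        = B ∩ {x | ((n + 1 : ℕ) : WithTop ℕ) ≤ τ x} := by
      ext x
      simp only [Set.mem_inter_iff, Set.mem_sdiff, Set.mem_ofPred_eq, and_assoc]
      refine and_congr_right fun _ => ?_
      cases h : τ x with
      | top => simp
      | coe k =>
        have hn : n ≤ k ∧ ¬k = n ↔ n + 1 ≤ k := by omega
        exact (and_congr WithTop.coe_le_coe (not_congr WithTop.coe_inj)).trans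
          (hn.trans WithTop.coe_le_coe.symm)
    rw [ih, ← measure_inter_add_sdiff (B ∩ {x | (n : WithTop ℕ) ≤ τ x}) (hτ n), h1, h2,
      Finset.sum_range_succ, add_assoc]

theorem toENNReal_eq_tsum (k : ℕ∞) :
    (k : ℝ≥0∞) = ∑' s : ℕ, if (s : ℕ∞) < k then (1 : ℝ≥0∞) else 0 := by
  induction k using ENat.recTopCoe with
  | top => simp
  | coe k =>
    rw [tsum_eq_sum (s := Finset.range k) fun s hs => if_neg (by simpa using hs),
      Finset.sum_congr rfl fun s hs => if_pos (by simpa using hs)]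
    simp

namespace Algorithm

variable {F : ExpFamily} {K : ℕ} (A : Algorithm K) (M M' : Model F K)

/-- The log-likelihood ratio of what is revealed in the first `min τ n` rounds. -/
noncomputable def stoppedLogLik (n : ℕ) (x : Sample K) : ℝ :=
  ∑ s ∈ Finset.range n, {x | (s : WithTop ℕ) < A.τ x}.indicator
    (fun x => M.roundLogRatio M' (A.V s x) (x s)) x

theorem stoppedLogLik_of_eq {n t : ℕ} (h : t ≤ n) {x : Sample K} (hx : A.τ x = t) :
    A.stoppedLogLik M M' n x = A.logLik M M' t x := by
  unfold stoppedLogLik SamplingRule.logLik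
  rw [← Finset.sum_subset (Finset.range_mono h)]
  · refine Finset.sum_congr rfl fun s hs => Set.indicator_of_mem ?_ _
    simpa [hx] using hs
  · intro s _ hs
    refine Set.indicator_of_notMem ?_ _
    simpa [hx] using hs

theorem stoppedLogLik_of_le {n : ℕ} {x : Sample K} (hx : (n : WithTop ℕ) ≤ A.τ x) :
    A.stoppedLogLik M M' n x = A.logLik M M' n x := by
  refine Finset.sum_congr rfl fun s hs => Set.indicator_of_mem ?_ _
  exact lt_of_lt_of_le (WithTop.coe_lt_coe.2 (Finset.mem_range.1 hs)) hx

theorem measurableSet_history_eq (t : ℕ) :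
    MeasurableSet[history A.V t] {x | A.τ x = t} :=
  A.isStoppingTime.measurableSet_eq_of_countable t

theorem measurableSet_history_lt (t : ℕ) :
    MeasurableSet[history A.V t] {x | (t : WithTop ℕ) < A.τ x} :=
  A.isStoppingTime.measurableSet_gt t

theorem measurableSet_history_ge (t : ℕ) :
    MeasurableSet[history A.V t] {x | (t : WithTop ℕ) ≤ A.τ x} :=
  A.isStoppingTime.measurableSet_ge_of_countable t

theorem measurable_stoppedLogLik (n : ℕ) : Measurable (A.stoppedLogLik M M' n) := by
  refine Finset.measurable_sum _ fun s _ => Measurable.indicator ?_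
    (A.history_le s _ (A.measurableSet_history_lt s))
  exact measurable_choice (A.measurable_V' s) (measurable_pi_apply s)
    (M.measurable_roundLogRatio M')

/-- The change of measure at the bounded stopping time `min τ n`. -/
theorem prob_eq_lintegral_stoppedLogLik (hG : M'.G = M.G) {n : ℕ} {B : Set (Sample K)}
    (hB : ∀ t < n, MeasurableSet[history A.V t] (B ∩ {x | A.τ x = t}))
    (hB' : MeasurableSet[history A.V n] (B ∩ {x | (n : WithTop ℕ) ≤ A.τ x}))
    (hBm : MeasurableSet B) :
    M'.prob B = ∫⁻ x in B, ENNReal.ofReal (Real.exp (A.stoppedLogLik M M' n x)) ∂M.prob := by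
  have hτ : ∀ t : ℕ, MeasurableSet {x | A.τ x = t} := fun t =>
    A.history_le t _ (A.measurableSet_history_eq t)
  rw [← withDensity_apply _ hBm, measure_eq_sum_stopping _ hτ n B,
    measure_eq_sum_stopping (M.prob.withDensity _) hτ n B]
  congr 1
  · refine Finset.sum_congr rfl fun t ht => ?_
    have ht' := Finset.mem_range.1 ht
    have hm := A.history_le t _ (hB t ht')
    rw [withDensity_apply _ hm, A.prob_eq_lintegral_logLik M M' hG t (hB t ht')]
    refine setLIntegral_congr_fun hm fun x hx => ?_
    simp only [A.stoppedLogLik_of_eq M M' ht'.le hx.2]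
  · have hm := A.history_le n _ hB'
    rw [withDensity_apply _ hm, A.prob_eq_lintegral_logLik M M' hG n hB']
    refine setLIntegral_congr_fun hm fun x hx => ?_
    simp only [A.stoppedLogLik_of_le M M' hx.2]

theorem measurableSet_history_choice (s : ℕ) (v : Fin K) :
    MeasurableSet[history A.V s] {x | (s : WithTop ℕ) < A.τ x ∧ A.V s x = v} :=
  MeasurableSet.inter (A.measurableSet_history_lt s)
    (A.measurable_V s (measurableSet_singleton v))

theorem indicator_eq_sum_choice (s : ℕ) (x : Sample K) :
    {x | (s : WithTop ℕ) < A.τ x}.indicator (fun x => M.roundLogRatio M' (A.V s x) (x s)) x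
      = ∑ v, {x | (s : WithTop ℕ) < A.τ x ∧ A.V s x = v}.indicator
          (fun x => M.roundLogRatio M' v (x s)) x := by
  rw [Finset.sum_eq_single (A.V s x)]
  · by_cases h : (s : WithTop ℕ) < A.τ x <;> simp [Set.indicator, h]
  · exact fun v _ hv => Set.indicator_of_notMem (fun h => hv h.2.symm) _
  · simp

theorem integrable_choice (s : ℕ) (v : Fin K) :
    Integrable ({x | (s : WithTop ℕ) < A.τ x ∧ A.V s x = v}.indicator
      fun x => M.roundLogRatio M' v (x s)) M.prob :=
  ((M.measurePreserving_eval s).integrable_comp_of_integrable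
    (M.integrable_roundLogRatio M' v)).indicator
    (A.history_le s _ (A.measurableSet_history_choice s v))

theorem integrable_stoppedLogLik (n : ℕ) : Integrable (A.stoppedLogLik M M' n) M.prob := by
  refine integrable_finsetSum _ fun s _ => ?_
  exact (integrable_finsetSum _ fun v _ => A.integrable_choice M M' s v).congr
    (ae_of_all _ fun x => (A.indicator_eq_sum_choice M M' s x).symm)

/-- The expected number of rounds, up to the stopping time, in which the vertex `v` is chosen. -/
noncomputable def expectedCount (v : Fin K) : ℝ≥0∞ :=
  ∑' s : ℕ, M.prob {x | (s : WithTop ℕ) < A.τ x ∧ A.V s x = v}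

theorem toENNReal_tau (x : Sample K) : ENat.toENNReal (A.τ x)
    = ∑' s : ℕ, {x | (s : WithTop ℕ) < A.τ x}.indicator (1 : Sample K → ℝ≥0∞) x := by
  refine (toENNReal_eq_tsum (A.τ x)).trans (tsum_congr fun s => ?_)
  simp only [Set.indicator, Set.mem_ofPred_eq, Pi.one_apply]
  rfl

theorem measurable_toENNReal_tau : Measurable fun x => ENat.toENNReal (A.τ x) := by
  simp_rw [toENNReal_tau]
  exact Measurable.tsum fun s => measurable_one.indicator
    (A.history_le s _ (A.measurableSet_history_lt s))

theorem sum_expectedCount : ∑ v, A.expectedCount M v = A.expectedTime M := by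
  have h1 : ∀ s : ℕ, M.prob {x | (s : WithTop ℕ) < A.τ x}
      = ∑ v, M.prob {x | (s : WithTop ℕ) < A.τ x ∧ A.V s x = v} := by
    intro s
    rw [← measure_biUnion_finset]
    · congr 1
      ext x
      simp
    · intro v _ w _ hvw
      exact Set.disjoint_left.2 fun x hx hx' => hvw (hx.2.symm.trans hx'.2)
    · exact fun v _ => A.history_le s _ (A.measurableSet_history_choice s v)
  have hm : ∀ s : ℕ, MeasurableSet {x | (s : WithTop ℕ) < A.τ x} := fun s =>
    A.history_le s _ (A.measurableSet_history_lt s)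
  unfold expectedTime
  simp_rw [toENNReal_tau]
  rw [lintegral_tsum fun s => (measurable_one.indicator (hm s)).aemeasurable]
  simp_rw [lintegral_indicator_one (hm _), h1]
  exact (Summable.tsum_finsetSum fun v _ => ENNReal.summable).symm

theorem neg_integral_stoppedLogLik_le (hT : A.expectedTime M ≠ ⊤) (n : ℕ) :
    - ∫ x, A.stoppedLogLik M M' n x ∂M.prob
      ≤ ∑ v, (A.expectedCount M v).toReal * ∑ u, (M.G v u : ℝ) * F.klReal (M.θ u) (M'.θ u) := by
  have h1 : ∫ x, A.stoppedLogLik M M' n x ∂M.prob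
      = ∑ s ∈ Finset.range n, ∑ v, ∫ x, {x | (s : WithTop ℕ) < A.τ x ∧ A.V s x = v}.indicator
          (fun x => M.roundLogRatio M' v (x s)) x ∂M.prob := by
    have : ∀ x, A.stoppedLogLik M M' n x = ∑ s ∈ Finset.range n, ∑ v,
        {x | (s : WithTop ℕ) < A.τ x ∧ A.V s x = v}.indicator
          (fun x => M.roundLogRatio M' v (x s)) x := fun x =>
      Finset.sum_congr rfl fun s _ => A.indicator_eq_sum_choice M M' s x
    simp_rw [this]
    rw [integral_finsetSum _ fun s _ => integrable_finsetSum _ fun v _ =>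
      A.integrable_choice M M' s v]
    exact Finset.sum_congr rfl fun s _ => integral_finsetSum _ fun v _ =>
      A.integrable_choice M M' s v
  rw [h1, Finset.sum_comm, ← Finset.sum_neg_distrib]
  refine Finset.sum_le_sum fun v _ => ?_
  have h2 : ∀ s : ℕ, ∫ x, {x | (s : WithTop ℕ) < A.τ x ∧ A.V s x = v}.indicator
        (fun x => M.roundLogRatio M' v (x s)) x ∂M.prob
      = M.prob.real {x | (s : WithTop ℕ) < A.τ x ∧ A.V s x = v}
          * - ∑ u, (M.G v u : ℝ) * F.klReal (M.θ u) (M'.θ u) := by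
    intro s
    have hm := A.measurableSet_history_choice s v
    rw [integral_indicator (A.history_le s _ hm),
      M.setIntegral_past s (A.history_le_past s _ hm) (M.measurable_roundLogRatio M' v),
      M.integral_roundLogRatio M' v]
  simp_rw [h2]
  rw [← Finset.sum_mul, mul_neg, neg_neg]
  refine mul_le_mul_of_nonneg_right ?_ (Finset.sum_nonneg fun u _ =>
    mul_nonneg (M.G v u).2.1 (F.klReal_nonneg (M.θ_mem u) (M'.θ_mem u)))
  have hfin : A.expectedCount M v ≠ ⊤ := by
    refine ne_top_of_le_ne_top hT ?_
    rw [← A.sum_expectedCount M]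
    exact Finset.single_le_sum (f := fun v => A.expectedCount M v) (fun _ _ => zero_le)
      (Finset.mem_univ v)
  simp only [measureReal_def]
  rw [← ENNReal.toReal_sum fun _ _ => measure_ne_top _ _]
  exact ENNReal.toReal_mono hfin (ENNReal.sum_le_tsum _)

end Algorithm

/-! ### Alternative models -/

variable {F : ExpFamily} {K : ℕ}

/-- The transportation inequality: an alternative model on the same graph with another best vertex
must be told apart from `M` by what the algorithm sees. -/
theorem Algorithm.klBer_le_of_alternative {δ : ℝ} (hδ : 0 < δ) (hδ' : δ ≤ 1 / 2)
    (A : Algorithm K) (hA : A.IsPC F δ) {M M' : Model F K} (hM : M.Observable) (hG : M'.G = M.G)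
    {a c : Fin K} (ha : M.IsBest a) (hc : M'.IsBest c) (hca : c ≠ a)
    (hT : A.expectedTime M ≠ ⊤) :
    klBer δ (1 - δ) ≤
      ∑ v, (A.expectedCount M v).toReal * ∑ u, (M.G v u : ℝ) * F.klReal (M.θ u) (M'.θ u) := by
  let E : ℕ → Set (Sample K) := fun n => {x | A.τ x < n ∧ A.recommend x = a}
  have hpiece : ∀ n t : ℕ, t < n →
      MeasurableSet[history A.V t] (E n ∩ {x | A.τ x = t}) := by
    intro n t ht
    have h1 : E n ∩ {x | A.τ x = t} = A.recommend ⁻¹' {a} ∩ {x | A.τ x = t} := by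
      ext x
      simp only [E, Set.mem_inter_iff, Set.mem_ofPred_eq, Set.mem_preimage, Set.mem_singleton_iff]
      refine ⟨fun h => ⟨h.1.2, h.2⟩, fun h => ⟨⟨?_, h.1⟩, h.2⟩⟩
      rw [h.2]
      exact WithTop.coe_lt_coe.2 ht
    rw [h1]
    refine (A.isStoppingTime.measurableSet_inter_eq_iff _ t).1 ?_
    exact MeasurableSet.inter (A.measurable_recommend (measurableSet_singleton a))
      (A.isStoppingTime.measurableSet_eq_of_countable' t)
  have hrest : ∀ n, E n ∩ {x | (n : WithTop ℕ) ≤ A.τ x} = ∅ := fun n =>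
    Set.eq_empty_of_forall_notMem fun x hx => hx.1.1.not_ge hx.2
  have hrec : ∀ S : Set (Fin K), MeasurableSet (A.recommend ⁻¹' S) := fun S =>
    A.isStoppingTime.measurableSpace_le _ (A.measurable_recommend S.toFinite.measurableSet)
  have hτ : ∀ n : ℕ, MeasurableSet {x | A.τ x < n} := fun n =>
    A.history_le n _ (A.isStoppingTime.measurableSet_lt_of_countable n)
  have hE : ∀ n, MeasurableSet (E n) := fun n => (hτ n).inter (hrec {a})
  have hU : (⋃ n, E n) = {x | A.τ x < ⊤} ∩ A.recommend ⁻¹' {a} := by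
    ext x
    simp only [E, Set.mem_iUnion, Set.mem_inter_iff, Set.mem_ofPred_eq, Set.mem_preimage,
      Set.mem_singleton_iff]
    constructor
    · rintro ⟨n, h1, h2⟩
      exact ⟨h1.trans_le le_top, h2⟩
    · rintro ⟨h1, h2⟩
      obtain ⟨k, hk⟩ := WithTop.ne_top_iff_exists.1 h1.ne
      refine ⟨k + 1, ?_, h2⟩
      rw [← hk]
      exact WithTop.coe_lt_coe.2 (Nat.lt_succ_self k)
  have hmono : Monotone E := fun m n hmn x hx =>
    ⟨hx.1.trans_le (WithTop.coe_le_coe.2 hmn), hx.2⟩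
  -- The algorithm stops almost surely under `M`, so it recommends `a` with probability above
  -- `1 - δ`, and already does so within a bounded number of rounds.
  have hfinite : ∀ᵐ x ∂M.prob, A.τ x < ⊤ := by
    filter_upwards [ae_lt_top A.measurable_toENNReal_tau hT] with x hx
    exact ENat.toENNReal_lt_top.1 hx
  have hlarge : ENNReal.ofReal (1 - δ) < M.prob (⋃ n, E n) := by
    have h1 : (1 : ℝ≥0∞) ≤ M.prob (⋃ n, E n)
        + M.prob {x | A.τ x < ⊤ ∧ A.recommend x ≠ a} := by
      have h2 : M.prob {x | A.τ x < ⊤} = 1 := by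
        rw [← measure_univ (μ := M.prob)]
        exact measure_congr (by filter_upwards [hfinite] with x hx; exact eq_true hx)
      rw [← h2]
      refine (measure_mono fun x hx => ?_).trans (measure_union_le _ _)
      rw [hU]
      by_cases h : A.recommend x = a
      · exact Or.inl ⟨hx, h⟩
      · exact Or.inr ⟨hx, h⟩
    by_contra! h
    have h3 := ENNReal.add_lt_add_of_le_of_lt (measure_ne_top _ _) h (hA M hM a ha)
    rw [← ENNReal.ofReal_add (by linarith) hδ.le, sub_add_cancel, ENNReal.ofReal_one] at h3
    exact absurd (h1.trans_lt h3) (lt_irrefl _)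
  obtain ⟨n, hn⟩ := ((tendsto_measure_iUnion_atTop hmono).eventually
    (lt_mem_nhds hlarge)).exists
  have hone := A.prob_eq_lintegral_stoppedLogLik M M' hG (n := n) (B := Set.univ)
    (fun t _ => by rw [Set.univ_inter]; exact A.measurableSet_history_eq t)
    (by rw [Set.univ_inter]; exact A.measurableSet_history_ge n) MeasurableSet.univ
  rw [measure_univ, Measure.restrict_univ] at hone
  have hq := A.prob_eq_lintegral_stoppedLogLik M M' hG (n := n) (B := E n) (hpiece n)
    (by rw [hrest]; exact @MeasurableSet.empty _ (history A.V n)) (hE n)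
  have hM' : M'.Observable := by
    unfold Model.Observable
    rw [hG]
    exact hM
  have hsmall : M'.prob (E n) ≤ ENNReal.ofReal δ := by
    refine (measure_mono fun x hx => ?_).trans (hA M' hM' c hc).le
    exact ⟨hx.1.trans_le le_top, fun h => hca (h.symm.trans hx.2)⟩
  exact (klBer_le_neg_integral (A.measurable_stoppedLogLik M M' n)
    (A.integrable_stoppedLogLik M M' n) (hE n) hδ hδ' hone.symm (hq ▸ hsmall) hn.le).trans
    (A.neg_integral_stoppedLogLik_le M M' hT n)

theorem le_of_forall_Ioo_le {f : ℝ → ℝ} {p q k : ℝ} (hpq : p < q)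
    (hf : ContinuousOn f (Set.Icc p q)) (h : ∀ x ∈ Set.Ioo p q, k ≤ f x) :
    ∀ x ∈ Set.Icc p q, k ≤ f x := by
  intro x hx
  rw [← closure_Ioo hpq.ne] at hx hf
  exact le_on_closure h continuousOn_const hf hx

/-- Among the alternatives, only the parameters of `a` and of one rival `u` need to move, and both
may move to a common value `s`. With this common value the best vertices may be tied, but a best one
among those other than `a` is at least as good as `a`, and becomes the unique best vertex after an
arbitrarily small increase of its parameter. -/
theorem le_of_forall_alternative {θ W : Fin K → ℝ} (hθ : ∀ w, θ w ∈ F.Θ) {a u : Fin K}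
    (hua : u ≠ a) (hbest : ∀ w, w ≠ a → F.mean (θ w) < F.mean (θ a)) {κ : ℝ}
    (h : ∀ η : Fin K → ℝ, (∀ w, η w ∈ F.Θ) → ∀ c, c ≠ a →
      (∀ w, w ≠ c → F.mean (η w) < F.mean (η c)) → κ ≤ ∑ w, W w * F.klReal (θ w) (η w))
    {s : ℝ} (hs : s ∈ Set.Icc (θ u) (θ a)) :
    κ ≤ W a * F.klReal (θ a) s + W u * F.klReal (θ u) s := by
  have hmono := F.mean_strictMono (hθ u) (hθ a) (hbest u hua).ne
  have hlt : ∀ w, w ≠ a → θ w < θ a := fun w hw =>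
    (hmono.lt_iff_lt (hθ w) (hθ a)).1 (hbest w hw)
  have hcont := fun r : ℝ => F.continuousOn_klReal (hθ u) (hθ a) r
  refine le_of_forall_Ioo_le (f := fun s => W a * F.klReal (θ a) s + W u * F.klReal (θ u) s)
    (hlt u hua) ((continuousOn_const.mul (hcont _)).add (continuousOn_const.mul (hcont _))) ?_ s hs
  clear s hs
  intro s hs
  have hsΘ : s ∈ F.Θ := F.ordConnected.out (hθ u) (hθ a) (Set.Ioo_subset_Icc_self hs)
  let η : Fin K → ℝ := fun w => if w = a ∨ w = u then s else θ w
  have hηΘ : ∀ w, η w ∈ F.Θ := fun w => by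
    simp only [η]
    split_ifs
    exacts [hsΘ, hθ w]
  have hηa : η a = s := by simp [η]
  have hηu : η u = s := by simp [η]
  have hηlt : ∀ w, η w < θ a := fun w => by
    simp only [η]
    split_ifs with hw
    · exact hs.2
    · exact hlt w fun h => hw (Or.inl h)
  obtain ⟨c, hc, hmax⟩ := Finset.exists_max_image (Finset.univ.erase a) η ⟨u, by simp [hua]⟩
  have hca : c ≠ a := Finset.ne_of_mem_erase hc
  have hle : ∀ w, η w ≤ η c := fun w => by
    by_cases hw : w = a
    · rw [hw, hηa, ← hηu]
      exact hmax u (by simp [hua])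
    · exact hmax w (by simp [hw])
  have hlim := le_of_forall_Ioo_le (k := κ)
    (f := fun x => ∑ w, W w * F.klReal (θ w) (Function.update η c x w)) (hηlt c) ?_ ?_ (η c)
    ⟨le_rfl, (hηlt c).le⟩
  · rw [Function.update_eq_self, Fintype.sum_eq_add a u hua.symm, hηa, hηu] at hlim
    · exact hlim
    · intro w hw
      have : η w = θ w := if_neg (by tauto)
      rw [this, F.klReal_self, mul_zero]
  · refine continuousOn_finsetSum _ fun w _ => ?_
    by_cases hw : w = c
    · subst hw
      simp only [Function.update_self]
      exact continuousOn_const.mul (F.continuousOn_klReal (hηΘ w) (hθ a) _)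
    · simp only [Function.update_of_ne hw]
      exact continuousOn_const
  · intro x hx
    have hxΘ : x ∈ F.Θ := F.ordConnected.out (hηΘ c) (hθ a) (Set.Ioo_subset_Icc_self hx)
    refine h _ (fun w => ?_) c hca fun w hw => ?_
    · by_cases hw : w = c
      · subst hw
        simpa using hxΘ
      · simpa [hw] using hηΘ w
    · rw [Function.update_self, Function.update_of_ne hw]
      exact hmono (hηΘ w) hxΘ ((hle w).trans_lt hx.1)

/-- The lower bound for one rival vertex `u`. -/
theorem Algorithm.klBer_le_pair {δ : ℝ} (hδ : 0 < δ) (hδ' : δ ≤ 1 / 2)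
    (A : Algorithm K) (hA : A.IsPC F δ) {M : Model F K} (hM : M.Observable)
    {a u : Fin K} (ha : M.IsBest a) (hua : u ≠ a) (hT : A.expectedTime M ≠ ⊤) {s : ℝ}
    (hs : s ∈ Set.Icc (M.θ u) (M.θ a)) :
    klBer δ (1 - δ) ≤ M.rate (fun v => (A.expectedCount M v).toReal) a * F.klReal (M.θ a) s
      + M.rate (fun v => (A.expectedCount M v).toReal) u * F.klReal (M.θ u) s := by
  refine le_of_forall_alternative M.θ_mem hua ha (fun η hη c hca hc => ?_) hs
  refine (A.klBer_le_of_alternative hδ hδ' hA (M' := ⟨M.G, η, hη⟩) hM rfl ha hc hca hT).trans_eq ?_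
  simp only [Finset.mul_sum]
  rw [Finset.sum_comm]
  refine Finset.sum_congr rfl fun w _ => ?_
  simp only [Model.rate, Matrix.mulVec, dotProduct, Matrix.transpose_apply, Matrix.of_apply]
  rw [Finset.sum_mul]
  exact Finset.sum_congr rfl fun v _ => by ring

end FeedbackGraph

open FeedbackGraph in
theorem theorem1 (F : FeedbackGraph.ExpFamily) (K : ℕ) (δ : ℝ) (hδ : 0 < δ) (hδ' : δ ≤ 1 / 2)
    (A : FeedbackGraph.Algorithm K) (hA : A.IsPC F δ)
    (M : FeedbackGraph.Model F K) (hM : M.Observable) (hcont : ∀ u x, M.reward u {x} = 0)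
    (a : Fin K) (ha : M.IsBest a) :
    M.charTime a * ENNReal.ofReal (FeedbackGraph.klBer δ (1 - δ)) ≤ A.expectedTime M := by
  rcases eq_or_ne (A.expectedTime M) ⊤ with hT | hT
  · rw [hT]
    exact le_top
  set N : Fin K → ℝ := fun v => (A.expectedCount M v).toReal with hN
  have hpair := fun u hua s hs => A.klBer_le_pair hδ hδ' hA hM (u := u) ha hua hT (s := s) hs
  have hNfin : ∀ v, A.expectedCount M v ≠ ⊤ := fun v => by
    refine ne_top_of_le_ne_top hT ?_
    rw [← A.sum_expectedCount M]
    exact Finset.single_le_sum (f := fun v => A.expectedCount M v) (fun _ _ => zero_le)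
      (Finset.mem_univ v)
  have hNT : ∑ v, N v = (A.expectedTime M).toReal := by
    rw [← A.sum_expectedCount M, ENNReal.toReal_sum fun v _ => hNfin v]
  have hlt : ∀ u, u ≠ a → M.θ u < M.θ a := fun u hu =>
    lt_of_not_ge fun h => (ha u hu).not_ge (F.mean_mono (M.θ_mem a) (M.θ_mem u) h)
  rcases eq_or_ne (A.expectedTime M) 0 with hT0 | hT0
  · by_cases hu : ∃ u, u ≠ a
    · obtain ⟨u, hua⟩ := hu
      have hN0 : (fun v => (A.expectedCount M v).toReal) = 0 := by
        have h0 : ∑ v, A.expectedCount M v = 0 := by rw [A.sum_expectedCount M, hT0]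
        ext v
        rw [(Finset.sum_eq_zero_iff.1 h0) v (Finset.mem_univ v)]
        rfl
      have h := hpair u hua _ ⟨le_rfl, (hlt u hua).le⟩
      rw [hN0] at h
      simp only [Model.rate, Matrix.mulVec_zero, Pi.zero_apply, zero_mul, add_zero] at h
      rw [ENNReal.ofReal_of_nonpos h, mul_zero]
      exact zero_le
    · push Not at hu
      have htop : M.infoRate a = ⊤ := by
        refine top_unique (le_iSup₂_of_le (Pi.single a 1) (single_mem_stdSimplex ℝ a) ?_)
        exact le_iInf₂ fun u hua => absurd (hu u) hua
      rw [Model.charTime, htop, ENNReal.inv_top, zero_mul]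
      exact zero_le
  set T := (A.expectedTime M).toReal with hTdef
  have hTpos : 0 < T := ENNReal.toReal_pos hT0 hT
  have hTeq : A.expectedTime M = ENNReal.ofReal T := (ENNReal.ofReal_toReal hT).symm
  have hrate : ∀ w, M.rate (fun v => N v / T) w = M.rate N w / T := fun w => by
    simp only [Model.rate, Matrix.mulVec, dotProduct]
    rw [Finset.sum_div]
    exact Finset.sum_congr rfl fun v _ => by ring
  have hrate0 : ∀ w, 0 ≤ M.rate N w := fun w => by
    simp only [Model.rate, Matrix.mulVec, dotProduct]
    exact Finset.sum_nonneg fun v _ => mul_nonneg (M.G v w).2.1 ENNReal.toReal_nonneg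
  have hmain : ENNReal.ofReal (klBer δ (1 - δ)) / A.expectedTime M ≤ M.infoRate a := by
    refine le_iSup₂_of_le (fun v => N v / T)
      ⟨fun v => div_nonneg ENNReal.toReal_nonneg hTpos.le, ?_⟩ (le_iInf₂ fun u hua => ?_)
    · rw [← Finset.sum_div, hNT, div_self hTpos.ne']
    refine ENNReal.div_le_of_le_mul' ?_
    rw [hrate, hrate]
    have hu0 := hrate0 u
    have ha0 := hrate0 a
    rcases (add_nonneg hu0 ha0).eq_or_lt with hm | hm
    · -- Neither `u` nor `a` is ever revealed.
      have h := hpair u hua _ ⟨le_rfl, (hlt u hua).le⟩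
      rw [show M.rate (fun v => (A.expectedCount M v).toReal) a = 0 by linarith,
        show M.rate (fun v => (A.expectedCount M v).toReal) u = 0 by linarith] at h
      rw [ENNReal.ofReal_of_nonpos (by linarith)]
      exact zero_le
    · have hα : M.rate N a / T / (M.rate N u / T + M.rate N a / T)
          = M.rate N a / (M.rate N u + M.rate N a) := by
        rw [← add_div, div_div_div_cancel_right₀ hTpos.ne']
      rw [hα]
      set α := M.rate N a / (M.rate N u + M.rate N a) with hαdef
      have hα0 : 0 ≤ α := div_nonneg ha0 hm.le
      have hα1 : α ≤ 1 := by rw [hαdef, div_le_one hm]; linarith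
      have hαm : α * (M.rate N u + M.rate N a) = M.rate N a := div_mul_cancel₀ _ hm.ne'
      have hb := ha u hua
      unfold Model.mean at hb
      have hs := F.paramOfMean_spec (M.θ_mem u) (M.θ_mem a) hb
        (x := α * F.mean (M.θ a) + (1 - α) * F.mean (M.θ u)) (by constructor <;> nlinarith)
      have h := hpair u hua _ hs
      unfold ExpFamily.genJS
      set s := F.paramOfMean (α * F.mean (M.θ a) + (1 - α) * F.mean (M.θ u))
      have hsΘ : s ∈ F.Θ := F.ordConnected.out (M.θ_mem u) (M.θ_mem a) hs
      have hka := F.klReal_nonneg (M.θ_mem a) hsΘ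
      have hku := F.klReal_nonneg (M.θ_mem u) hsΘ
      rw [F.klDiv_law (M.θ_mem a) hsΘ, F.klDiv_law (M.θ_mem u) hsΘ,
        ← ENNReal.ofReal_mul hα0, ← ENNReal.ofReal_mul (sub_nonneg.2 hα1),
        ← ENNReal.ofReal_add (mul_nonneg hα0 hka) (mul_nonneg (sub_nonneg.2 hα1) hku), hTeq,
        ← ENNReal.ofReal_mul (by positivity), ← ENNReal.ofReal_mul hTpos.le]
      refine ENNReal.ofReal_le_ofReal (h.trans_eq ?_)
      have h1 : T * ((M.rate N u / T + M.rate N a / T) * (α * F.klReal (M.θ a) s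
          + (1 - α) * F.klReal (M.θ u) s)) = (M.rate N u + M.rate N a) *
          (α * F.klReal (M.θ a) s + (1 - α) * F.klReal (M.θ u) s) := by
        field_simp
      rw [h1]
      linear_combination (F.klReal (M.θ u) s - F.klReal (M.θ a) s) * hαm
  rw [ENNReal.div_le_iff' hT0 hT] at hmain
  rw [Model.charTime, mul_comm, ← div_eq_mul_inv]
  exact ENNReal.div_le_of_le_mul hmain
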